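/- Write $S^d\mathbb{C}^{3}$ for the space of forms of degree $d\ge 0$ in $x_0,x_1,x_2$ over $\mathbb{C}$, and let $v_d$ be the Veronese map $\mathbb{P}^2\to\mathbb{P}(S^d\mathbb{C}^3)$, $v_d([a_0:a_1:a_2])=[(a_0x_0+a_1x_1+a_2x_2)^d]$. For a finite set $A\subset\mathbb{P}^2$ let $\ell(A)$ be its cardinality and $\langle v_d(A)\rangle$ the linear span of the points of $v_d(A)$. The set $A$ *computes* $T\in S^d\mathbb{C}^3$ if $T\in\langle v_d(A)\rangle$; it is *non-redundant* if moreover no proper subset of $A$ computes $T$. The *rank* of $T$ is the minimal cardinality of a finite set computing $T$, and $A$ *computes the rank of $T$* if $A$ is a non-redundant set computing $T$ and $\ell(A)$ is the rank of $T$. The *Hilbert function* $h_A(j)$, $j\ge 0$, is the rank of the linear map $S^j\mathbb{C}^3\to\mathbb{C}^{\ell(A)}$ that evaluates forms of degree $j$ at a set of homogeneous coordinates of the points of $A$. The *$j$-th Kruskal rank* $k_j(A)$ is the largest $k\le\ell(A)$ such that $\dim\langle v_j(A')\rangle=\ell(v_j(A'))-1$ (projective dimension) for all $A'\subset A$ with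 $\ell(A')\le k$. **Theorem 3.7.** Let $T\in S^d\mathbb{C}^3$, let $A\subset\mathbb{P}^2$ be a non-redundant finite set computing $T$, and put $r=\ell(A)$. Then $A$ computes the rank of $T$ if one of the following holds, with $m\ge 0$ an integer: - $d=2m$ and $h_A(m)=r$ (in which case $r\le\binom{m+2}{2}$); - $d=2m+1$, $k_m(A)=\min\left\{\binom{m+2}{2},r\right\}$ and $h_A(m+1)=r\le\binom{m+2}{2}+\left\lceil\frac m2\right\rceil$. -/

import Mathlib

namespace Waring

open MvPolynomial

/-- The space `S^d ℂ^{n+1}` of forms of degree `d` in the variables `x_0, …, x_n`. -/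
abbrev Form (n d : ℕ) : Type :=
  MvPolynomial.homogeneousSubmodule (Fin (n + 1)) ℂ d

/-- The projective space `ℙ^n` of lines in `ℂ^{n+1}`; the point `[a_0 : … : a_n]` also stands for
the class of the linear form `a_0 x_0 + … + a_n x_n`. -/
abbrev PSpace (n : ℕ) : Type :=
  Projectivization ℂ (Fin (n + 1) → ℂ)

/-- The linear form `a_0 x_0 + … + a_n x_n`. -/
noncomputable def linForm {n : ℕ} (a : Fin (n + 1) → ℂ) : MvPolynomial (Fin (n + 1)) ℂ :=
  ∑ i, C (a i) * X i

theorem linForm_isHomogeneous {n : ℕ} (a : Fin (n + 1) → ℂ) : (linForm a).IsHomogeneous 1 :=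
  IsHomogeneous.sum _ _ _ fun i _ => by
    simpa using (isHomogeneous_C (Fin (n + 1)) (a i)).mul (isHomogeneous_X ℂ i)

theorem linForm_smul {n : ℕ} (c : ℂ) (a : Fin (n + 1) → ℂ) :
    linForm (c • a) = c • linForm a := by
  simp [linForm, Finset.smul_sum, smul_eq_C_mul, mul_assoc]

theorem linForm_ne_zero {n : ℕ} {a : Fin (n + 1) → ℂ} (ha : a ≠ 0) : linForm a ≠ 0 := by
  intro h
  apply ha
  funext j
  have h2 := congrArg (MvPolynomial.eval (Pi.single j (1 : ℂ))) h
  simpa [linForm, Pi.single_apply] using h2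

/-- The `d`-th power `(a_0 x_0 + … + a_n x_n)^d`, as a form of degree `d`. -/
noncomputable def powForm {n : ℕ} (d : ℕ) (a : Fin (n + 1) → ℂ) : Form n d :=
  ⟨linForm a ^ d, by
    rw [MvPolynomial.mem_homogeneousSubmodule]
    simpa using (linForm_isHomogeneous a).pow d⟩

theorem powForm_ne_zero {n : ℕ} (d : ℕ) {a : Fin (n + 1) → ℂ} (ha : a ≠ 0) :
    powForm d a ≠ 0 := by
  intro h
  exact pow_ne_zero d (linForm_ne_zero ha) (congrArg Subtype.val h)

theorem powForm_smul {n : ℕ} (d : ℕ) (c : ℂ) (a : Fin (n + 1) → ℂ) :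
    powForm d (c • a) = c ^ d • powForm d a := by
  apply Subtype.ext
  simp [powForm, linForm_smul, smul_pow]

/-- The Veronese map `v_d : ℙ^n → ℙ(S^d ℂ^{n+1})`, `[L] ↦ [L^d]`. -/
noncomputable def veronese {n : ℕ} (d : ℕ) : PSpace n → Projectivization ℂ (Form n d) :=
  Projectivization.lift
    (fun v => Projectivization.mk ℂ (powForm d v.1) (powForm_ne_zero d v.2))
    (by
      rintro ⟨a, ha⟩ ⟨b, hb⟩ t h
      rw [Projectivization.mk_eq_mk_iff']
      exact ⟨t ^ d, by rw [← powForm_smul]; exact congrArg (powForm d) h.symm⟩)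

/-- The linear span `⟨v_d(A)⟩`, as a vector subspace of `S^d ℂ^{n+1}` (the affine cone). Its
vector space dimension is one more than its projective dimension. -/
noncomputable def veroneseSpan {n : ℕ} (d : ℕ) (A : Finset (PSpace n)) :
    Submodule ℂ (Form n d) :=
  ⨆ P ∈ A, (veronese d P).submodule

/-- `A` computes `T` if `T ∈ ⟨v_d(A)⟩`. -/
def Computes {n d : ℕ} (A : Finset (PSpace n)) (T : Form n d) : Prop :=
  T ∈ veroneseSpan d A

/-- `A` is a non-redundant set computing `T`: it computes `T` and no proper subset of it does. -/
def NonRedundant {n d : ℕ} (A : Finset (PSpace n)) (T : Form n d) : Prop :=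
  Computes A T ∧ ∀ A' : Finset (PSpace n), A' ⊂ A → ¬ Computes A' T

/-- The (Waring) rank of `T`: the least cardinality of a finite set computing `T`. -/
noncomputable def rank {n d : ℕ} (T : Form n d) : ℕ :=
  sInf {k : ℕ | ∃ A : Finset (PSpace n), Computes A T ∧ A.card = k}

/-- `A` computes the rank of `T`. -/
def ComputesRank {n d : ℕ} (A : Finset (PSpace n)) (T : Form n d) : Prop :=
  NonRedundant A T ∧ A.card = rank T

/-- The `d`-th Kruskal rank of `A`: the largest `k ≤ ℓ(A)` such that for every subset `A'` of `A`
with at most `k` points, `v_d(A')` is linearly independent, that is, the projective dimension of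
`⟨v_d(A')⟩` is the number of points of `v_d(A')` minus one. -/
noncomputable def kruskalRank {n : ℕ} (d : ℕ) (A : Finset (PSpace n)) : ℕ :=
  sSup {k : ℕ | k ≤ A.card ∧ ∀ A' : Finset (PSpace n), A' ⊆ A → A'.card ≤ k →
    Module.finrank ℂ (veroneseSpan d A') = (veronese d '' (A' : Set (PSpace n))).ncard}

/-- The evaluation map of degree `j` on a family `Y` of vectors of `ℂ^{n+1}`. -/
noncomputable def evalMap {n : ℕ} {ι : Type} (j : ℕ) (Y : ι → Fin (n + 1) → ℂ) :
    Form n j →ₗ[ℂ] (ι → ℂ) where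
  toFun F := fun i => MvPolynomial.eval (Y i) F.1
  map_add' F G := by
    funext i
    simp
  map_smul' c F := by
    funext i
    simp

/-- The Hilbert function `h_Z(j)`, `j ≥ 0`: the rank of the evaluation map of degree `j` on a set
of homogeneous coordinates of the points of `Z`. -/
noncomputable def hilbertFun {n : ℕ} (Z : Finset (PSpace n)) (j : ℕ) : ℕ :=
  Module.finrank ℂ (LinearMap.range (evalMap j fun P : Z => P.1.rep))

end Waring

namespace Waring

open MvPolynomial

/-! By apolarity, a linear relation among powers of linear forms is a relation among evaluations at
the corresponding points (`sum_smul_powForm_eq_zero_iff`). A second set `B` computing `T` therefore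
presents one functional on forms of degree `d` in two ways: as a sum over `A`, whose coefficients
are nonzero by non-redundancy, and as a sum over `B`. What must be shown is |A| ≤ |B|.

If `A` is separated in degrees `a` and `b` with `a + b = d`, linear algebra suffices
(`card_le_card_of_separates`). This settles even degree, and odd degree when |A| ≤ N, where N is the
number of monomials of degree `m`.

For |A| ≥ N in degree 2m+1, suppose |B| < |A|. The forms of degree m+1 through `A` and those through
`B` all lie in the kernel of a contraction map of rank N. Counting dimensions
(`card_add_finrank_ge`) gives two independent forms H G₁ and H G₂ of degree m+1 vanishing on A ∪ B,
with G₁, G₂ coprime. The points off H are common zeros of G₁ and G₂, hence impose independent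
conditions in the degree left after removing H (`eq_zero_of_sum_eval_eq_zero`). So the two sums
agree there coefficient by coefficient, and the points of `A` off H belong to `B`. At most N points
of `A` lie on H, since otherwise a multiple of H of degree `m` would vanish on N points of `A`;
hence the first bound applies on H. Adding both contributions gives |A| ≤ |B|, a contradiction. -/

/-! ### Decompositions and apolarity -/

theorem submodule_veronese {n d : ℕ} (P : PSpace n) :
    (veronese d P).submodule = Submodule.span ℂ {powForm d P.rep} := by
  have h : veronese d P =
      Projectivization.mk ℂ (powForm d P.rep) (powForm_ne_zero d P.rep_nonzero) := by
    conv_lhs => rw [← P.mk_rep]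
    rfl
  rw [h, Projectivization.submodule_mk]

theorem veroneseSpan_eq_span {n d : ℕ} (A : Finset (PSpace n)) :
    veroneseSpan d A = Submodule.span ℂ ((fun P : PSpace n => powForm d P.rep) '' A) := by
  simp only [veroneseSpan, submodule_veronese, Submodule.iSup_span]
  congr 1
  ext x
  simp [eq_comm]

theorem computes_iff {n d : ℕ} (A : Finset (PSpace n)) (T : Form n d) :
    Computes A T ↔ ∃ c : PSpace n → ℂ, ∑ P ∈ A, c P • powForm d P.rep = T := by
  classical
  rw [Computes, veroneseSpan_eq_span, Submodule.mem_span_image_finset_iff_exists_fun]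
  constructor
  · rintro ⟨c, rfl⟩
    refine ⟨fun P => if h : P ∈ A then c ⟨P, h⟩ else 0, ?_⟩
    rw [← Finset.sum_coe_sort A]
    exact Finset.sum_congr rfl fun P _ => by simp
  · rintro ⟨c, rfl⟩
    exact ⟨fun P => c P, Finset.sum_coe_sort A fun P => c P • powForm d P.rep⟩

theorem coeff_linForm_pow {n : ℕ} {d : ℕ} (a : Fin (n + 1) → ℂ) {α : Fin (n + 1) →₀ ℕ}
    (hα : α.degree = d) :
    coeff α (linForm a ^ d) = Nat.multinomial Finset.univ α * ∏ i, a i ^ α i := by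
  classical
  have key : ∀ k : Fin (n + 1) → ℕ,
      (Nat.multinomial Finset.univ k : MvPolynomial (Fin (n + 1)) ℂ) *
        ∏ i, (C (a i) * X i) ^ k i =
      monomial (Finsupp.equivFunOnFinite.symm k)
        (Nat.multinomial Finset.univ k * ∏ i, a i ^ k i) := by
    intro k
    rw [monomial_eq, C_mul, map_natCast, map_prod, mul_assoc,
      Finsupp.prod_fintype _ _ (by simp), ← Finset.prod_mul_distrib]
    simp [mul_pow]
  rw [linForm, Finset.sum_pow_eq_sum_piAntidiag, coeff_sum,
    Finset.sum_eq_single (α : Fin (n + 1) → ℕ)]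
  · rw [key, coeff_monomial, if_pos (by simp)]
  · intro k _ hk
    rw [key, coeff_monomial, if_neg]
    rintro rfl
    exact hk (by simp)
  · intro h
    refine absurd ?_ h
    rw [Finset.mem_piAntidiag]
    exact ⟨by rw [← hα, Finsupp.degree_eq_sum], by simp⟩

/-- Apolarity: linear relations among powers of linear forms are the relations among the
evaluations at the corresponding points. -/
theorem sum_smul_powForm_eq_zero_iff {n d : ℕ} {ι : Type*} (s : Finset ι) (e : ι → ℂ)
    (a : ι → Fin (n + 1) → ℂ) :
    ∑ i ∈ s, e i • powForm d (a i) = 0 ↔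
      ∀ F : MvPolynomial (Fin (n + 1)) ℂ, F.IsHomogeneous d → ∑ i ∈ s, e i * eval (a i) F = 0 := by
  have hco : ∀ α : Fin (n + 1) →₀ ℕ, α.degree = d →
      coeff α (∑ i ∈ s, e i • powForm d (a i) : Form n d).1 =
        Nat.multinomial Finset.univ α * ∑ i ∈ s, e i * ∏ j, a i j ^ α j := by
    intro α hα
    rw [AddSubmonoidClass.coe_finsetSum, coeff_sum, Finset.mul_sum]
    refine Finset.sum_congr rfl fun i _ => ?_
    rw [SetLike.val_smul, coeff_smul, powForm, coeff_linForm_pow _ hα, smul_eq_mul]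
    ring
  constructor
  · intro h F hF
    have h0 : ∀ α ∈ F.support, ∑ i ∈ s, e i * ∏ j, a i j ^ α j = 0 := by
      intro α hα
      have hd : α.degree = d := by
        by_contra hne
        exact (mem_support_iff.1 hα) (hF.coeff_eq_zero hne)
      have h1 := hco α hd
      rw [h] at h1
      -- Characteristic zero: the multinomial factors can be cancelled.
      have h2 : (Nat.multinomial Finset.univ α : ℂ) ≠ 0 :=
        Nat.cast_ne_zero.2 (Nat.multinomial_pos _ _).ne'
      simpa [h2] using h1.symm
    simp only [eval_eq', Finset.mul_sum]
    rw [Finset.sum_comm]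
    refine Finset.sum_eq_zero fun α hα => ?_
    rw [← mul_zero (coeff α F), ← h0 α hα, Finset.mul_sum]
    exact Finset.sum_congr rfl fun i _ => by ring
  · intro h
    apply Subtype.ext
    ext α
    by_cases hα : α.degree = d
    · rw [hco α hα]
      have := h (monomial α 1) (isHomogeneous_monomial 1 hα)
      simp only [eval_monomial, one_mul, Finsupp.prod_fintype _ _ (fun _ => pow_zero _)] at this
      simp [this]
    · exact ((mem_homogeneousSubmodule _ _).1 (Subtype.prop _)).coeff_eq_zero hα

/-! ### Separation of points by forms -/

/-- Forms of degree `j` separate the points of `A`: they impose independent conditions. -/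
def Separates {n : ℕ} (j : ℕ) (A : Finset (PSpace n)) : Prop :=
  ∀ P ∈ A, ∃ F : MvPolynomial (Fin (n + 1)) ℂ, F.IsHomogeneous j ∧ eval P.rep F = 1 ∧
    ∀ Q ∈ A, Q ≠ P → eval Q.rep F = 0

theorem Separates.mono {n j : ℕ} {A B : Finset (PSpace n)} (h : Separates j A) (hB : B ⊆ A) :
    Separates j B := fun P hP =>
  let ⟨F, hF, h1, h2⟩ := h P (hB hP)
  ⟨F, hF, h1, fun Q hQ => h2 Q (hB hQ)⟩

theorem separates_of_range_eq_top {n j : ℕ} {A : Finset (PSpace n)}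
    (h : LinearMap.range (evalMap j fun P : A => P.1.rep) = ⊤) : Separates j A := by
  classical
  intro P hP
  obtain ⟨F, hF⟩ := LinearMap.range_eq_top.1 h (Pi.single ⟨P, hP⟩ 1)
  refine ⟨F.1, F.2, ?_, fun Q hQ hQP => ?_⟩
  · simpa [evalMap] using congrFun hF ⟨P, hP⟩
  · simpa [evalMap, hQP] using congrFun hF ⟨Q, hQ⟩

theorem Separates.range_eq_top {n j : ℕ} {A : Finset (PSpace n)} (h : Separates j A) :
    LinearMap.range (evalMap j fun P : A => P.1.rep) = ⊤ := by
  classical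
  choose F hF h1 h2 using h
  rw [LinearMap.range_eq_top]
  intro v
  refine ⟨∑ P : A, v P • (⟨F P.1 P.2, hF P.1 P.2⟩ : Form n j), ?_⟩
  rw [map_sum]
  funext Q
  rw [Finset.sum_apply, Finset.sum_eq_single Q]
  · simp [evalMap, h1]
  · intro P _ hP
    simp [evalMap, h2 P.1 P.2 Q.1 Q.2 fun hh => hP (Subtype.ext hh.symm)]
  · simp

theorem separates_of_hilbertFun {n j : ℕ} {A : Finset (PSpace n)}
    (h : hilbertFun A j = A.card) : Separates j A := by
  apply separates_of_range_eq_top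
  apply Submodule.eq_top_of_finrank_eq
  rw [hilbertFun] at h
  simp [h]

/-- If evaluation is not onto, a nonzero functional kills its range, and the coordinates of that
functional form a nontrivial relation `e`. -/
theorem separates_of_forall {n j : ℕ} {A : Finset (PSpace n)}
    (h : ∀ e : PSpace n → ℂ, (∀ F : MvPolynomial (Fin (n + 1)) ℂ, F.IsHomogeneous j →
      ∑ P ∈ A, e P * eval P.rep F = 0) → ∀ P ∈ A, e P = 0) : Separates j A := by
  classical
  apply separates_of_range_eq_top
  by_contra hne
  obtain ⟨f, hf, hle⟩ := Submodule.exists_le_ker_of_lt_top _ (lt_top_iff_ne_top.2 hne)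
  apply hf
  let e : PSpace n → ℂ := fun P =>
    if hP : P ∈ A then f (fun Q => if (⟨P, hP⟩ : A) = Q then 1 else 0) else 0
  have he : ∀ P : A, e P = f (fun Q => if P = Q then 1 else 0) := fun P => by simp [e]
  have h0 := h e (fun F hF => by
    have h1 : f (evalMap j (fun P : A => P.1.rep) ⟨F, hF⟩) = 0 := hle ⟨_, rfl⟩
    rw [LinearMap.pi_apply_eq_sum_univ] at h1
    rw [← Finset.sum_coe_sort A, ← h1]
    refine Finset.sum_congr rfl fun P _ => ?_
    rw [he, smul_eq_mul, mul_comm]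
    rfl)
  ext x
  rw [LinearMap.comp_apply, LinearMap.pi_apply_eq_sum_univ f]
  simp only [← he]
  simp [h0]

theorem finrank_form (n j : ℕ) : Module.finrank ℂ (Form n j) = (n + j).choose n := by
  classical
  have h1 : {d : Fin (n + 1) →₀ ℕ | Finsupp.degree d = j} =
      ((Finset.univ : Finset (Fin (n + 1))).finsuppAntidiag j : Set _) := by
    ext d
    simp [Finsupp.degree_eq_sum]
  rw [((LinearEquiv.ofEq _ _ (homogeneousSubmodule_eq_finsupp_supported _ ℂ j)).trans
    (AddMonoidAlgebra.supportedEquivFinsupp (R := ℂ) (S := ℂ) _)).finrank_eq, h1,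
    Module.finrank_finsupp_self]
  simp only [SetLike.coe_sort_coe, Fintype.card_coe, Finset.card_finsuppAntidiag_nat_eq_choose,
    Finset.card_univ, Fintype.card_fin]
  rw [show n + 1 + j - 1 = n + j by omega, Nat.choose_symm_add]

instance (n j : ℕ) : FiniteDimensional ℂ (Form n j) :=
  Module.Finite.iff_fg.2 (homogeneousSubmodule_fg _ _ _)

theorem Separates.card_le {n j : ℕ} {A : Finset (PSpace n)} (h : Separates j A) :
    A.card ≤ (n + j).choose n := by
  have := LinearMap.finrank_range_le (evalMap j fun P : A => P.1.rep)
  rw [h.range_eq_top, finrank_form] at this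
  simpa using this

/-- Evaluation is then onto between spaces of equal dimension, hence injective. -/
theorem Separates.eq_zero {n j : ℕ} {A : Finset (PSpace n)} (h : Separates j A)
    (hA : A.card = (n + j).choose n) {F : MvPolynomial (Fin (n + 1)) ℂ} (hF : F.IsHomogeneous j)
    (h0 : ∀ P ∈ A, eval P.rep F = 0) : F = 0 := by
  have hs := LinearMap.range_eq_top.1 h.range_eq_top
  have hi := (LinearMap.injective_iff_surjective_of_finrank_eq_finrank
    (by rw [finrank_form]; simp [hA])).2 hs
  have : (⟨F, hF⟩ : Form n j) = 0 := hi (by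
    rw [map_zero]; funext P; exact h0 P.1 P.2)
  exact congrArg Subtype.val this

/-! ### Lower bound from separation in complementary degrees -/

/-- If a functional that is a combination of evaluations at `A` with nonzero coefficients is a
combination of evaluations at `B`, and if `A` is separated in the two complementary degrees
`a` and `b`, then `B` has at least as many points as `A`. -/
theorem card_le_card_of_separates {n a b : ℕ} {A B : Finset (PSpace n)} (hAa : Separates a A)
    (hAb : Separates b A) {c c' : PSpace n → ℂ} (hc : ∀ P ∈ A, c P ≠ 0)
    (h : ∀ F : MvPolynomial (Fin (n + 1)) ℂ, F.IsHomogeneous (a + b) →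
      ∑ P ∈ A, c P * eval P.rep F = ∑ P ∈ B, c' P * eval P.rep F) : A.card ≤ B.card := by
  classical
  by_contra! hlt
  choose! F hF hF1 hF2 using hAa
  choose! G hG hG1 hG2 using hAb
  -- There are more separators than points of `B`, so some nontrivial combination `E` of them
  -- vanishes on `B`.
  have hdep : ¬ LinearIndependent ℂ (fun P : A => fun Q : B => eval Q.1.rep (F P.1)) := by
    intro hli
    have := hli.fintype_card_le_finrank
    simp at this
    omega
  obtain ⟨t, ht, P₀, hP₀⟩ := Fintype.not_linearIndependent_iff.1 hdep
  let E := ∑ P : A, t P • F P.1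
  have hE : E.IsHomogeneous a :=
    (mem_homogeneousSubmodule _ _).1 (Submodule.sum_mem _ fun P _ => Submodule.smul_mem _ _
      ((mem_homogeneousSubmodule _ _).2 (hF P.1 P.2)))
  have hEB : ∀ Q ∈ B, eval Q.rep E = 0 := by
    intro Q hQ
    have := congrFun ht ⟨Q, hQ⟩
    simpa [E, smul_eval] using this
  have hEA : eval P₀.1.rep E = t P₀ := by
    simp only [E, map_sum, smul_eval]
    rw [Finset.sum_eq_single P₀]
    · rw [hF1 _ P₀.2, mul_one]
    · intro P _ hP
      rw [hF2 P.1 P.2 P₀.1 P₀.2 fun hh => hP (Subtype.ext hh.symm), mul_zero]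
    · simp
  -- `E` kills the sum over `B`, while `G P₀` leaves only the term of `P₀` in the sum over `A`.
  have := h (E * G P₀.1) (hE.mul (hG _ P₀.2))
  rw [Finset.sum_eq_single P₀.1, Finset.sum_eq_zero] at this
  · simp [hEA, hG1 _ P₀.2, hP₀, hc _ P₀.2] at this
  · intro Q hQ
    simp [hEB Q hQ]
  · intro Q hQ hne
    simp [hG2 _ P₀.2 Q hQ hne]
  · exact fun hh => absurd P₀.2 hh

/-! ### Separation from the Kruskal rank -/

theorem separates_of_linearIndependent {n j : ℕ} {A : Finset (PSpace n)}
    (h : LinearIndependent ℂ fun P : A => powForm j P.1.rep) : Separates j A := by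
  apply separates_of_forall
  intro e he P hP
  rw [← sum_smul_powForm_eq_zero_iff (d := j) A e fun P => P.rep, ← Finset.sum_coe_sort A] at he
  exact Fintype.linearIndependent_iff.1 h (fun P => e P.1) he ⟨P, hP⟩

/-- Two distinct points of a projective space are separated by a linear form. -/
theorem exists_linear_separating {n : ℕ} {P Q : PSpace n} (h : P ≠ Q) :
    ∃ l : MvPolynomial (Fin (n + 1)) ℂ, l.IsHomogeneous 1 ∧ eval P.rep l ≠ 0 ∧
      eval Q.rep l = 0 := by
  have hP : P.rep ∉ Submodule.span ℂ {Q.rep} := by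
    intro hmem
    obtain ⟨a, ha⟩ := Submodule.mem_span_singleton.1 hmem
    apply h
    rw [← P.mk_rep, ← Q.mk_rep, Projectivization.mk_eq_mk_iff']
    exact ⟨a, ha⟩
  obtain ⟨f, hf, hle⟩ := Submodule.exists_le_ker_of_notMem hP
  have hf' : ∀ x, f x = eval x (linForm fun i => f fun j => if i = j then 1 else 0) := by
    intro x
    rw [LinearMap.pi_apply_eq_sum_univ]
    simp [linForm, mul_comm]
  refine ⟨linForm fun i => f fun j => if i = j then 1 else 0, linForm_isHomogeneous _, ?_, ?_⟩
  · rwa [← hf']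
  · rw [← hf']
    exact hle (Submodule.mem_span_singleton_self _)

theorem veronese_injective {n j : ℕ} (hj : j ≠ 0) :
    Function.Injective (veronese (n := n) j) := by
  intro P Q h
  by_contra hne
  obtain ⟨l, hl, hP, hQ⟩ := exists_linear_separating hne
  have h1 : powForm j P.rep ∈ Submodule.span ℂ {powForm j Q.rep} := by
    rw [← submodule_veronese, ← h, submodule_veronese]
    exact Submodule.mem_span_singleton_self _
  obtain ⟨c, hc⟩ := Submodule.mem_span_singleton.1 h1
  -- A two-term relation is tested on `l ^ j`, which vanishes at `Q` because `j ≠ 0`.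
  have h2 := (sum_smul_powForm_eq_zero_iff (d := j) Finset.univ ![c, -1] ![Q.rep, P.rep]).1
    (by
      rw [Fin.sum_univ_two]
      change c • powForm j Q.rep + (-1 : ℂ) • powForm j P.rep = 0
      rw [hc]
      apply Subtype.ext
      simp) (l ^ j) (by simpa using hl.pow j)
  simp [Fin.sum_univ_two, hQ, hj, hP] at h2

/-- The Kruskal rank compares dimensions with the number of image points. In degree 0 all points
have the same image, so `hj` is needed to recover the number of points of `A'`. -/
theorem separates_of_card_le_kruskalRank {n j : ℕ} {A A' : Finset (PSpace n)} (hA' : A' ⊆ A)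
    (hj : j = 0 → A'.card ≤ 1) (h : A'.card ≤ kruskalRank j A) : Separates j A' := by
  classical
  have hbdd : BddAbove {k : ℕ | k ≤ A.card ∧ ∀ A' : Finset (PSpace n), A' ⊆ A → A'.card ≤ k →
    Module.finrank ℂ (veroneseSpan j A') = (veronese j '' (A' : Set (PSpace n))).ncard} :=
    ⟨A.card, fun k hk => hk.1⟩
  have hmem := Nat.sSup_mem ⟨0, by
    refine ⟨Nat.zero_le _, fun B _ hB => ?_⟩
    obtain rfl : B = ∅ := by simpa using hB
    simp [veroneseSpan_eq_span]⟩ hbdd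
  have hr := hmem.2 A' hA' h
  have hinj : Set.InjOn (veronese (n := n) j) A' := by
    by_cases h0 : j = 0
    · intro P hP Q hQ _
      exact Finset.card_le_one.1 (hj h0) P hP Q hQ
    · exact (veronese_injective h0).injOn
  rw [hinj.ncard_image, Set.ncard_coe_finset] at hr
  apply separates_of_linearIndependent
  rw [linearIndependent_iff_card_eq_finrank_span, Fintype.card_coe, ← hr, veroneseSpan_eq_span,
    Set.finrank, Set.image_eq_range]
  rfl

/-! ### Linear changes of coordinates -/

/-- The linear change of coordinates `F ↦ F ∘ L`. -/
noncomputable def subst {n : ℕ} (L : (Fin (n + 1) → ℂ) →ₗ[ℂ] (Fin (n + 1) → ℂ)) :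
    MvPolynomial (Fin (n + 1)) ℂ →ₐ[ℂ] MvPolynomial (Fin (n + 1)) ℂ :=
  aeval fun i => linForm fun j => L (Pi.single j 1) i

theorem eval_subst {n : ℕ} (L : (Fin (n + 1) → ℂ) →ₗ[ℂ] (Fin (n + 1) → ℂ))
    (x : Fin (n + 1) → ℂ) (F : MvPolynomial (Fin (n + 1)) ℂ) :
    eval x (subst L F) = eval (L x) F := by
  have hx : ∀ i, eval x (linForm fun j => L (Pi.single j 1) i) = L x i := by
    intro i
    conv_rhs => rw [← Finset.univ_sum_single x, map_sum, Finset.sum_apply]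
    simp only [linForm, map_sum, map_mul, eval_C, eval_X]
    refine Finset.sum_congr rfl fun j _ => ?_
    rw [show Pi.single j (x j) = x j • (Pi.single j 1 : Fin (n + 1) → ℂ) by
      rw [← Pi.single_smul, smul_eq_mul, mul_one], map_smul, Pi.smul_apply, smul_eq_mul, mul_comm]
  induction F using MvPolynomial.induction_on with
  | C a => simp [subst]
  | add p q hp hq => simp [hp, hq]
  | mul_X p i hp =>
    rw [map_mul, map_mul, map_mul, hp, eval_X, ← hx i]
    simp [subst]

theorem isHomogeneous_subst {n d : ℕ} (L : (Fin (n + 1) → ℂ) →ₗ[ℂ] (Fin (n + 1) → ℂ))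
    {F : MvPolynomial (Fin (n + 1)) ℂ} (hF : F.IsHomogeneous d) :
    (subst L F).IsHomogeneous d := by
  have h := hF.aeval _ fun i => linForm_isHomogeneous fun j => L (Pi.single j 1) i
  rw [one_mul] at h
  exact h

theorem subst_subst {n : ℕ} (L : (Fin (n + 1) → ℂ) ≃ₗ[ℂ] (Fin (n + 1) → ℂ))
    (F : MvPolynomial (Fin (n + 1)) ℂ) :
    subst L.symm.toLinearMap (subst L.toLinearMap F) = F := by
  apply MvPolynomial.funext
  intro x
  simp [eval_subst]

theorem isRelPrime_subst {n : ℕ} (L : (Fin (n + 1) → ℂ) ≃ₗ[ℂ] (Fin (n + 1) → ℂ))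
    {F G : MvPolynomial (Fin (n + 1)) ℂ} (h : IsRelPrime F G) :
    IsRelPrime (subst L.toLinearMap F) (subst L.toLinearMap G) := by
  intro D hF hG
  have hF' := map_dvd (subst L.symm.toLinearMap) hF
  have hG' := map_dvd (subst L.symm.toLinearMap) hG
  rw [subst_subst] at hF' hG'
  have := (h hF' hG').map (subst L.symm.symm.toLinearMap)
  rwa [subst_subst] at this

theorem eval_smul_of_isHomogeneous {n d : ℕ} {F : MvPolynomial (Fin n) ℂ}
    (hF : F.IsHomogeneous d) (c : ℂ) (x : Fin n → ℂ) : eval (c • x) F = c ^ d * eval x F := by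
  rw [eval_eq', eval_eq', Finset.mul_sum]
  refine Finset.sum_congr rfl fun α hα => ?_
  have hd : ∑ i, α i = d := by
    rw [← Finsupp.degree_eq_sum]
    by_contra hne
    exact mem_support_iff.1 hα (hF.coeff_eq_zero hne)
  simp only [Pi.smul_apply, smul_eq_mul, mul_pow, Finset.prod_mul_distrib,
    Finset.prod_pow_eq_pow_sum, hd]
  ring

/-! ### Elimination, and moving points by coordinate changes -/

/-- Two polynomials over a unique factorization domain without common factor, the first of them
monic, generate an ideal that contains a nonzero constant. -/
theorem exists_mul_add_mul_eq_C {S : Type*} [CommRing S] [IsDomain S] [IsIntegrallyClosed S]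
    {f g : Polynomial S} (hf : f.Monic) (hfg : IsRelPrime f g) :
    ∃ u v D, D ≠ 0 ∧ f * u + g * v = Polynomial.C D := by
  let K := FractionRing S
  have hinj := IsFractionRing.injective S K
  -- Gauss's lemma: up to a constant, a common factor over `K` comes from a monic `D'` over `S`, and
  -- divisibility by a monic polynomial descends to `S`.
  have hcop : IsCoprime (f.map (algebraMap S K)) (g.map (algebraMap S K)) := by
    rw [← isRelPrime_iff_isCoprime]
    intro D hDf hDg
    have hD0 : D ≠ 0 := by
      rintro rfl
      exact (hf.map _).ne_zero (zero_dvd_iff.1 hDf)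
    obtain ⟨D', hD'⟩ := IsIntegrallyClosed.eq_map_mul_C_of_dvd K hf hDf
    have hlc : IsUnit (Polynomial.C D.leadingCoeff) :=
      Polynomial.isUnit_C.2 (Polynomial.leadingCoeff_ne_zero.2 hD0).isUnit
    have hmon : D'.Monic := by
      have h1 := congrArg Polynomial.leadingCoeff hD'
      rw [Polynomial.leadingCoeff_mul, Polynomial.leadingCoeff_C,
        Polynomial.leadingCoeff_map_of_injective hinj] at h1
      have h2 := mul_right_cancel₀ (Polynomial.leadingCoeff_ne_zero.2 hD0)
        (h1.trans (one_mul _).symm)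
      exact hinj (by rw [h2, map_one])
    have hdvd : D'.map (algebraMap S K) ∣ D := ⟨_, hD'.symm⟩
    have hu : IsUnit D' := hfg
      ((Polynomial.map_dvd_map _ hinj hmon).1 (hdvd.trans hDf))
      ((Polynomial.map_dvd_map _ hinj hmon).1 (hdvd.trans hDg))
    rw [← hD']
    exact (hu.map (Polynomial.mapRingHom (algebraMap S K))).mul hlc
  by_cases hdeg : f.natDegree = 0
  · refine ⟨1, 0, 1, one_ne_zero, ?_⟩
    rw [Polynomial.eq_one_of_monic_natDegree_zero hf hdeg]
    simp
  -- The constant is the resultant; its image in `K` is the resultant of coprime polynomials, hence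
  -- nonzero.
  obtain ⟨u, v, _, _, h⟩ := Polynomial.exists_mul_add_mul_eq_C_resultant f g le_rfl le_rfl
    (Or.inl hdeg)
  refine ⟨u, v, _, ?_, h⟩
  intro h0
  have h1 := Polynomial.resultant_map_map f g f.natDegree g.natDegree (algebraMap S K)
  rw [h0, map_zero, ← Polynomial.natDegree_map_eq_of_injective hinj f,
    ← Polynomial.natDegree_map_eq_of_injective hinj g] at h1
  exact (Polynomial.resultant_eq_zero_iff.1 h1).2 hcop

/-- A pair of independent vectors is the beginning of a basis of `ℂ³`. -/
theorem exists_linearEquiv_of_linearIndependent {p q : Fin 3 → ℂ}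
    (h : LinearIndependent ℂ ![p, q]) :
    ∃ L : (Fin 3 → ℂ) ≃ₗ[ℂ] (Fin 3 → ℂ), L (Pi.single 0 1) = p ∧ L (Pi.single 1 1) = q := by
  have hlt : Submodule.span ℂ (Set.range ![p, q]) < ⊤ := by
    rw [lt_top_iff_ne_top]
    intro htop
    have h1 := finrank_span_eq_card h
    rw [htop, finrank_top] at h1
    simp at h1
  obtain ⟨r, -, hr⟩ := SetLike.exists_of_lt hlt
  have hli : LinearIndependent ℂ (Fin.snoc ![p, q] r : Fin 3 → Fin 3 → ℂ) :=
    linearIndependent_finSnoc.2 ⟨h, hr⟩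
  let b := basisOfLinearIndependentOfCardEqFinrank hli (by simp)
  have hb : ∀ i, b.equivFun.symm (Pi.single i 1) = (Fin.snoc ![p, q] r : Fin 3 → Fin 3 → ℂ) i := by
    intro i
    simp [b, Module.Basis.equivFun_symm_apply, Pi.single_apply]
  exact ⟨b.equivFun.symm, by rw [hb]; rfl, by rw [hb]; rfl⟩

theorem exists_linearEquiv_apply_single {p : Fin 3 → ℂ} (hp : p ≠ 0) :
    ∃ L : (Fin 3 → ℂ) ≃ₗ[ℂ] (Fin 3 → ℂ), L (Pi.single 0 1) = p := by
  have hlt : Submodule.span ℂ {p} < ⊤ := by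
    rw [lt_top_iff_ne_top]
    intro htop
    have h1 := finrank_span_singleton (K := ℂ) hp
    rw [htop, finrank_top] at h1
    simp at h1
  obtain ⟨q, -, hq⟩ := SetLike.exists_of_lt hlt
  have hli : LinearIndependent ℂ ![p, q] := by
    rw [LinearIndependent.pair_iff' hp]
    intro a ha
    exact hq (Submodule.mem_span_singleton.2 ⟨a, ha⟩)
  obtain ⟨L, hL, -⟩ := exists_linearEquiv_of_linearIndependent hli
  exact ⟨L, hL⟩

/-- This coefficient has degree 0, so a form not vanishing at [1 : 0 : … : 0] becomes monic in x₀
after scaling. -/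
theorem coeff_finSuccEquiv_self {n d : ℕ} {F : MvPolynomial (Fin (n + 1)) ℂ}
    (hF : F.IsHomogeneous d) :
    (finSuccEquiv ℂ n F).coeff d = C (eval (Pi.single 0 1) F) := by
  have h0 := hF.finSuccEquiv_coeff_isHomogeneous d 0 rfl
  rw [← totalDegree_zero_iff_isHomogeneous, totalDegree_eq_zero_iff_eq_C] at h0
  rw [h0, finSuccEquiv_coeff_coeff, eval_eq', Finset.sum_eq_single (Finsupp.cons d 0)]
  · simp [Fin.prod_univ_succ, Finsupp.cons]
  · intro α hα hne
    have hd : ∑ i, α i = d := by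
      rw [← Finsupp.degree_eq_sum]
      by_contra hne
      exact mem_support_iff.1 hα (hF.coeff_eq_zero hne)
    have : ∃ i : Fin n, α i.succ ≠ 0 := by
      by_contra! hall
      apply hne
      rw [Fin.sum_univ_succ, Finset.sum_eq_zero fun i _ => hall i, add_zero] at hd
      ext i
      refine Fin.cases ?_ (fun i => ?_) i
      · simpa using hd
      · simpa using hall i
    obtain ⟨i, hi⟩ := this
    rw [Finset.prod_eq_zero (Finset.mem_univ i.succ), mul_zero]
    simp [hi]
  · intro h
    simp [notMem_support_iff.1 h]

theorem natDegree_finSuccEquiv_le {n d : ℕ} {F : MvPolynomial (Fin (n + 1)) ℂ}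
    (hF : F.IsHomogeneous d) : (finSuccEquiv ℂ n F).natDegree ≤ d := by
  rw [natDegree_finSuccEquiv]
  exact (degreeOf_le_totalDegree _ _).trans hF.totalDegree_le

/-! ### Restriction to a line -/

/-- Restriction of a polynomial in three variables to the line `x₂ = 0`, in the affine coordinate
`x₀ / x₁`. -/
noncomputable def lineRes : MvPolynomial (Fin 3) ℂ →ₐ[ℂ] Polynomial ℂ :=
  aeval ![Polynomial.X, 1, 0]

theorem eval_lineRes (s : ℂ) (F : MvPolynomial (Fin 3) ℂ) :
    (lineRes F).eval s = eval ![s, 1, 0] F := by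
  induction F using MvPolynomial.induction_on with
  | C a => simp [lineRes]
  | add p q hp hq => simp [hp, hq]
  | mul_X p i hp =>
    rw [map_mul, map_mul, Polynomial.eval_mul, hp]
    fin_cases i <;> simp [lineRes]

/-- Two forms in three variables without common factor have no common zero on a suitable line,
chosen as the line `x₂ = 0` after a linear change of coordinates; moreover the first form does not
vanish at `[1 : 0 : 0]`. -/
theorem exists_isCoprime_lineRes {d : ℕ} {G₁ G₂ : MvPolynomial (Fin 3) ℂ}
    (h₁ : G₁.IsHomogeneous d) (h0 : G₁ ≠ 0) (hrel : IsRelPrime G₁ G₂) :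
    ∃ L : (Fin 3 → ℂ) ≃ₗ[ℂ] (Fin 3 → ℂ), eval (Pi.single 0 1) (subst L.toLinearMap G₁) ≠ 0 ∧
      IsCoprime (lineRes (subst L.toLinearMap G₁)) (lineRes (subst L.toLinearMap G₂)) := by
  obtain ⟨p, hp, hp0⟩ : ∃ p, eval p G₁ ≠ 0 ∧ p ≠ 0 := by
    -- The extra factor `X 0` forces `p ≠ 0`, even when `G₁` is constant.
    have hX : G₁ * X 0 ≠ 0 := mul_ne_zero h0 (X_ne_zero _)
    obtain ⟨p, hp⟩ : ∃ p, eval p (G₁ * X 0) ≠ 0 := by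
      by_contra! hall
      exact hX (MvPolynomial.funext fun x => by simpa using hall x)
    rw [map_mul, eval_X] at hp
    refine ⟨p, left_ne_zero_of_mul hp, ?_⟩
    rintro rfl
    simp at hp
  obtain ⟨L₁, hL₁⟩ := exists_linearEquiv_apply_single hp0
  set K₁ := subst L₁.toLinearMap G₁ with hK₁
  set K₂ := subst L₁.toLinearMap G₂ with hK₂
  have hK₁h : K₁.IsHomogeneous d := isHomogeneous_subst _ h₁
  have hc : eval (Pi.single 0 1) K₁ ≠ 0 := by
    rw [hK₁, eval_subst]
    simpa [hL₁] using hp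
  set c := eval (Pi.single 0 1) K₁
  have hmon : (finSuccEquiv ℂ 2 (C c⁻¹ * K₁)).Monic := by
    apply Polynomial.monic_of_natDegree_le_of_coeff_eq_one d
    · exact natDegree_finSuccEquiv_le (hK₁h.C_mul _)
    · rw [coeff_finSuccEquiv_self (hK₁h.C_mul _)]
      simp [c, hc]
  have hrel' : IsRelPrime (finSuccEquiv ℂ 2 (C c⁻¹ * K₁)) (finSuccEquiv ℂ 2 K₂) := by
    intro D hD₁ hD₂
    have hu : IsUnit (C c⁻¹ : MvPolynomial (Fin 3) ℂ) := (inv_ne_zero hc).isUnit.map C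
    have h1 := map_dvd (finSuccEquiv ℂ 2).symm hD₁
    have h2 := map_dvd (finSuccEquiv ℂ 2).symm hD₂
    rw [AlgEquiv.symm_apply_apply] at h1 h2
    have := (isRelPrime_subst L₁ hrel (hu.dvd_mul_left.1 h1) h2).map (finSuccEquiv ℂ 2)
    rwa [AlgEquiv.apply_symm_apply] at this
  obtain ⟨u, v, D, hD, huv⟩ := exists_mul_add_mul_eq_C hmon hrel'
  -- On the line through [1 : 0 : 0] and [0 : y] the identity `huv` specializes to a Bézout identity
  -- with nonzero constant D(y).
  obtain ⟨y, hy, hy0⟩ : ∃ y, eval y D ≠ 0 ∧ y ≠ 0 := by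
    have hX : D * X 0 ≠ 0 := mul_ne_zero hD (X_ne_zero _)
    obtain ⟨p, hp⟩ : ∃ p, eval p (D * X 0) ≠ 0 := by
      by_contra! hall
      exact hX (MvPolynomial.funext fun x => by simpa using hall x)
    rw [map_mul, eval_X] at hp
    refine ⟨p, left_ne_zero_of_mul hp, ?_⟩
    rintro rfl
    simp at hp
  have hli : LinearIndependent ℂ ![(Pi.single 0 1 : Fin 3 → ℂ), Fin.cons 0 y] := by
    rw [LinearIndependent.pair_iff]
    intro s t hst
    have hs : s = 0 := by simpa using congrFun hst 0
    refine ⟨hs, ?_⟩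
    by_contra ht
    apply hy0
    funext i
    have := congrFun hst i.succ
    simpa [hs, ht] using this
  obtain ⟨L₂, hL₂0, hL₂1⟩ := exists_linearEquiv_of_linearIndependent hli
  have hL₂ : ∀ s : ℂ, L₂ ![s, 1, 0] = Fin.cons s y := by
    intro s
    have : (![s, 1, 0] : Fin 3 → ℂ) = s • Pi.single 0 1 + Pi.single 1 1 := by
      funext i
      fin_cases i <;> simp
    rw [this, map_add, map_smul, hL₂0, hL₂1]
    funext i
    refine Fin.cases ?_ (fun i => ?_) i <;> simp
  have hsub : ∀ F, subst (L₂.trans L₁).toLinearMap F =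
      subst L₂.toLinearMap (subst L₁.toLinearMap F) := by
    intro F
    apply MvPolynomial.funext
    intro x
    simp [eval_subst]
  have hres : ∀ F, lineRes (subst L₂.toLinearMap F) =
      (finSuccEquiv ℂ 2 F).map (eval y) := by
    intro F
    apply Polynomial.funext
    intro s
    rw [eval_lineRes, eval_subst, ← eval_eq_eval_mv_eval']
    exact congrArg (fun z => eval z F) (hL₂ s)
  refine ⟨L₂.trans L₁, ?_, ?_⟩
  · rw [hsub, eval_subst]
    simpa [hL₂0] using hc
  · rw [hsub, hsub, hres, hres]
    have h := congrArg (Polynomial.map (eval y)) huv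
    rw [Polynomial.map_add, Polynomial.map_mul, Polynomial.map_mul, Polynomial.map_C, map_mul,
      Polynomial.map_mul] at h
    refine ⟨Polynomial.C (eval y D)⁻¹ * (u.map (eval y) *
      (finSuccEquiv ℂ 2 (C c⁻¹)).map (eval y)), Polynomial.C (eval y D)⁻¹ * v.map (eval y), ?_⟩
    have h2 : Polynomial.C (eval y D)⁻¹ * Polynomial.C (eval y D) = 1 := by
      rw [← Polynomial.C_mul, inv_mul_cancel₀ hy, Polynomial.C_1]
    rw [← h2, ← h]
    ring

theorem coeff_lineRes {d k l : ℕ} {F : MvPolynomial (Fin 3) ℂ} (hF : F.IsHomogeneous d)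
    (h : k + l = d) : (lineRes F).coeff k =
      coeff (Finsupp.single 0 k + Finsupp.single 1 l) F := by
  have hev : lineRes F = ∑ α ∈ F.support,
      Polynomial.C (coeff α F) * (Polynomial.X ^ α 0 * 0 ^ α 2) := by
    rw [lineRes, aeval_def, eval₂_eq']
    refine Finset.sum_congr rfl fun α _ => ?_
    rw [Fin.prod_univ_three]
    simp
  rw [hev, Polynomial.finsetSum_coeff,
    Finset.sum_eq_single (Finsupp.single 0 k + Finsupp.single 1 l)]
  · simp
  · intro α hα hne
    rw [Polynomial.coeff_C_mul]
    by_cases h2 : α 2 = 0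
    · rw [h2, pow_zero, mul_one, Polynomial.coeff_X_pow, if_neg, mul_zero]
      intro hk
      have hd : ∑ i, α i = d := by
        rw [← Finsupp.degree_eq_sum]
        by_contra hne
        exact mem_support_iff.1 hα (hF.coeff_eq_zero hne)
      rw [Fin.sum_univ_three] at hd
      apply hne
      ext i
      fin_cases i
      · simp [hk]
      · simp
        omega
      · simp [h2]
    · simp [h2]
  · intro h
    simp [notMem_support_iff.1 h]

theorem natDegree_lineRes_le {d : ℕ} {F : MvPolynomial (Fin 3) ℂ} (hF : F.IsHomogeneous d) :
    (lineRes F).natDegree ≤ d := by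
  rw [lineRes, aeval_def, eval₂_eq']
  refine Polynomial.natDegree_sum_le_of_forall_le _ _ fun α hα => ?_
  have hd : ∑ i, α i = d := by
    rw [← Finsupp.degree_eq_sum]
    by_contra hne
    exact mem_support_iff.1 hα (hF.coeff_eq_zero hne)
  rw [Fin.sum_univ_three] at hd
  rw [Fin.prod_univ_three]
  refine (Polynomial.natDegree_C_mul_le _ _).trans ?_
  by_cases h2 : α 2 = 0
  · simp [h2]
    omega
  · simp [h2]

theorem coeff_lineRes_self {d : ℕ} {F : MvPolynomial (Fin 3) ℂ} (hF : F.IsHomogeneous d) :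
    (lineRes F).coeff d = eval (Pi.single 0 1) F := by
  have h := coeff_finSuccEquiv_self hF
  rw [coeff_lineRes hF (add_zero d)]
  have h' := congrArg (coeff 0) h
  rw [finSuccEquiv_coeff_coeff, coeff_zero_C] at h'
  rw [← h']
  congr 1
  ext i
  refine Fin.cases ?_ (fun i => ?_) i <;> simp

/-- By `coeff_lineRes`, the restriction records exactly the coefficients of the monomials free of
x₂. -/
theorem exists_eq_X_mul_of_lineRes_eq_zero {d : ℕ} {F : MvPolynomial (Fin 3) ℂ}
    (hF : F.IsHomogeneous (d + 1)) (h : lineRes F = 0) :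
    ∃ F' : MvPolynomial (Fin 3) ℂ, F'.IsHomogeneous d ∧ F = X 2 * F' := by
  have hdvd : (X 2 : MvPolynomial (Fin 3) ℂ) ∣ F := by
    rw [X_dvd_iff_modMonomial_eq_zero]
    ext α
    rw [coeff_zero]
    by_cases hle : Finsupp.single 2 1 ≤ α
    · exact coeff_modMonomial_of_le _ hle
    · rw [coeff_modMonomial_of_not_le _ hle]
      have h2 : α 2 = 0 := by
        by_contra hne
        apply hle
        rw [Finsupp.single_le_iff]
        omega
      by_cases hd : α.degree = d + 1
      · have hd' := hd
        rw [Finsupp.degree_eq_sum, Fin.sum_univ_three, h2, add_zero] at hd'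
        have hα : α = Finsupp.single 0 (α 0) + Finsupp.single 1 (α 1) := by
          ext i
          fin_cases i <;> simp [h2]
        rw [hα, ← coeff_lineRes hF hd', h, Polynomial.coeff_zero]
      · exact hF.coeff_eq_zero hd
  obtain ⟨F', rfl⟩ := hdvd
  refine ⟨F', ?_, rfl⟩
  intro α hα
  have h1 : coeff (Finsupp.single 2 1 + α) (X 2 * F') ≠ 0 := by rwa [coeff_X_mul]
  have h2 := hF h1
  simp only [map_add, Finsupp.weight_single] at h2
  change 1 • 1 + Finsupp.weight 1 α = d + 1 at h2
  change Finsupp.weight 1 α = d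
  rw [smul_eq_mul] at h2
  omega

theorem exists_lineRes_eq {d : ℕ} {u : Polynomial ℂ} (hu : u.natDegree ≤ d) :
    ∃ U : MvPolynomial (Fin 3) ℂ, U.IsHomogeneous d ∧ lineRes U = u := by
  refine ⟨∑ i ∈ Finset.range (d + 1), C (u.coeff i) * (X 0 ^ i * X 1 ^ (d - i)), ?_, ?_⟩
  · refine IsHomogeneous.sum _ _ _ fun i hi => IsHomogeneous.C_mul ?_ _
    have := (isHomogeneous_X_pow (R := ℂ) (0 : Fin 3) i).mul
      (isHomogeneous_X_pow (R := ℂ) (1 : Fin 3) (d - i))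
    rwa [Nat.add_sub_cancel' (by simpa [Nat.lt_succ_iff] using hi)] at this
  · rw [map_sum]
    conv_rhs => rw [u.as_sum_range' (d + 1) (by omega)]
    refine Finset.sum_congr rfl fun i _ => ?_
    simp [lineRes, Polynomial.C_mul_X_pow_eq_monomial]

/-- Division with small degrees by a pair of coprime polynomials. -/
theorem exists_eq_mul_add_mul_of_isCoprime {n d : ℕ} {g₁ g₂ f : Polynomial ℂ}
    (h : IsCoprime g₁ g₂) (h0 : g₁ ≠ 0) (h₁ : g₁.natDegree = n) (h₂ : g₂.natDegree ≤ n)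
    (hd : 2 * n ≤ n + d + 1) (hf : f.natDegree ≤ n + d) :
    ∃ u v : Polynomial ℂ, u.natDegree ≤ d ∧ v.natDegree ≤ d ∧ f = u * g₁ + v * g₂ := by
  obtain ⟨a, b, hab⟩ := h
  -- Reduction modulo `g₁` brings the degree of `v` below `n ≤ d + 1`; the degree of `u` is then
  -- read off from `u * g₁ = f - v * g₂`.
  set v := (f * b) % g₁ with hv
  set u := f * a + (f * b) / g₁ * g₂ with hu
  have hdiv : g₁ * ((f * b) / g₁) + v = f * b := EuclideanDomain.div_add_mod _ _
  have hfuv : f = u * g₁ + v * g₂ := by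
    calc f = f * (a * g₁ + b * g₂) := by rw [hab, mul_one]
      _ = f * a * g₁ + (f * b) * g₂ := by ring
      _ = u * g₁ + v * g₂ := by rw [← hdiv, hu]; ring
  have hvn : v = 0 ∨ v.natDegree < n := by
    by_cases hv0 : v = 0
    · exact Or.inl hv0
    · right
      rw [← h₁]
      exact Polynomial.natDegree_lt_natDegree hv0 (Polynomial.degree_mod_lt _ h0)
  have hvd : v.natDegree ≤ d := by
    rcases hvn with h | h
    · simp [h]
    · omega
  refine ⟨u, v, ?_, hvd, hfuv⟩
  by_cases hu0 : u = 0
  · simp [hu0]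
  have h3 : (u * g₁).natDegree ≤ n + d := by
    rw [show u * g₁ = f - v * g₂ from eq_sub_of_add_eq hfuv.symm]
    refine (Polynomial.natDegree_sub_le _ _).trans (max_le hf ?_)
    rcases hvn with h | h
    · simp [h]
    · exact Polynomial.natDegree_mul_le.trans (by omega)
  rw [Polynomial.natDegree_mul hu0 h0, h₁] at h3
  omega

/-- The coprime restrictions generate every polynomial of the relevant degree, so a combination of
`H₁`, `H₂` matches `F` on the line and the difference is divisible by x₂. -/
theorem exists_eq_combination {n d : ℕ} {H₁ H₂ F : MvPolynomial (Fin 3) ℂ}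
    (h₁ : H₁.IsHomogeneous n) (h₂ : H₂.IsHomogeneous n) (h0 : eval (Pi.single 0 1) H₁ ≠ 0)
    (hcop : IsCoprime (lineRes H₁) (lineRes H₂)) (hd : 2 * n ≤ d + 1)
    (hF : F.IsHomogeneous (d + 1)) :
    ∃ U V F' : MvPolynomial (Fin 3) ℂ, F'.IsHomogeneous d ∧ F = U * H₁ + V * H₂ + X 2 * F' := by
  rw [← coeff_lineRes_self h₁] at h0
  have hne : lineRes H₁ ≠ 0 := by
    intro h
    simp [h] at h0
  have hdeg : (lineRes H₁).natDegree = n :=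
    le_antisymm (natDegree_lineRes_le h₁) (Polynomial.le_natDegree_of_ne_zero h0)
  obtain ⟨e, he⟩ : ∃ e, d + 1 = n + e := ⟨d + 1 - n, by omega⟩
  obtain ⟨u, v, hu, hv, huv⟩ := exists_eq_mul_add_mul_of_isCoprime (d := e) hcop hne hdeg
    (natDegree_lineRes_le h₂) (by omega) (he ▸ natDegree_lineRes_le hF)
  obtain ⟨U, hU, rfl⟩ := exists_lineRes_eq hu
  obtain ⟨V, hV, rfl⟩ := exists_lineRes_eq hv
  have hU' := hU.mul h₁
  have hV' := hV.mul h₂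
  rw [add_comm e n, ← he] at hU' hV'
  obtain ⟨F', hF', h⟩ := exists_eq_X_mul_of_lineRes_eq_zero (hF.sub (hU'.add hV')) (by
    rw [map_sub, map_add, map_mul, map_mul, ← huv, sub_self])
  exact ⟨U, V, F', hF', by rw [← h]; ring⟩

/-! ### Common zeros of two curves without common component -/

/-- A finite set of common zeros of two plane curves of degree `n` without common component
imposes independent conditions on forms of degree `k ≥ 2 n - 1`. -/
theorem eq_zero_of_sum_eval_eq_zero {n k : ℕ} {G₁ G₂ : MvPolynomial (Fin 3) ℂ}
    (h₁ : G₁.IsHomogeneous n) (h₂ : G₂.IsHomogeneous n) (h0 : G₁ ≠ 0) (hrel : IsRelPrime G₁ G₂)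
    {Z : Finset (PSpace 2)} (hZ₁ : ∀ P ∈ Z, eval P.rep G₁ = 0) (hZ₂ : ∀ P ∈ Z, eval P.rep G₂ = 0)
    (hk : 2 * n ≤ k + 1) {e : PSpace 2 → ℂ}
    (he : ∀ F : MvPolynomial (Fin 3) ℂ, F.IsHomogeneous k → ∑ P ∈ Z, e P * eval P.rep F = 0) :
    ∀ P ∈ Z, e P = 0 := by
  classical
  obtain ⟨L, hL0, hcop⟩ := exists_isCoprime_lineRes h₁ h0 hrel
  set H₁ := subst L.toLinearMap G₁ with hH₁
  set H₂ := subst L.toLinearMap G₂ with hH₂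
  have hH₁h : H₁.IsHomogeneous n := isHomogeneous_subst _ h₁
  have hH₂h : H₂.IsHomogeneous n := isHomogeneous_subst _ h₂
  let b : PSpace 2 → Fin 3 → ℂ := fun P => L.symm P.rep
  have hb : ∀ P F, eval (b P) (subst L.toLinearMap F) = eval P.rep F := by
    intro P F
    simp [eval_subst, b]
  have hb₁ : ∀ P ∈ Z, eval (b P) H₁ = 0 := fun P hP => (hb P G₁).trans (hZ₁ P hP)
  have hb₂ : ∀ P ∈ Z, eval (b P) H₂ = 0 := fun P hP => (hb P G₂).trans (hZ₂ P hP)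
  -- The chosen line misses `Z`: [1 : 0 : 0] is excluded by `hL0`, its other points by `hcop`.
  have hb2 : ∀ P ∈ Z, b P 2 ≠ 0 := by
    intro P hP h2
    by_cases h1 : b P 1 = 0
    · have hbP : b P = b P 0 • Pi.single 0 1 := by
        funext i
        fin_cases i <;> simp [h1, h2]
      have := hb₁ P hP
      rw [hbP, eval_smul_of_isHomogeneous hH₁h] at this
      have h00 := eq_zero_of_pow_eq_zero ((mul_eq_zero.1 this).resolve_right hL0)
      have : b P = 0 := by rw [hbP, h00, zero_smul]
      exact P.rep_nonzero ((LinearEquiv.map_eq_zero_iff _).1 this)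
    · have hbP : b P = b P 1 • ![b P 0 / b P 1, 1, 0] := by
        funext i
        fin_cases i <;> simp [h1, h2, mul_div_cancel₀]
      have hz : ∀ H : MvPolynomial (Fin 3) ℂ, H.IsHomogeneous n → eval (b P) H = 0 →
          (lineRes H).eval (b P 0 / b P 1) = 0 := by
        intro H hH hz
        rw [hbP, eval_smul_of_isHomogeneous hH] at hz
        rw [eval_lineRes]
        exact (mul_eq_zero.1 hz).resolve_left (pow_ne_zero _ h1)
      obtain ⟨u, v, huv⟩ := hcop
      have := congrArg (Polynomial.eval (b P 0 / b P 1)) huv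
      simp [hz H₁ hH₁h (hb₁ P hP), hz H₂ hH₂h (hb₂ P hP)] at this
  -- The relation propagates to all higher degrees: on `Z` a form of degree k+i+1 equals x₂ F', and
  -- the new weight 1/x₂ cancels the factor x₂.
  have key : ∀ i : ℕ, ∀ F : MvPolynomial (Fin 3) ℂ, F.IsHomogeneous (k + i) →
      ∑ P ∈ Z, e P * (b P 2)⁻¹ ^ i * eval (b P) F = 0 := by
    intro i
    induction i with
    | zero =>
      intro F hF
      rw [← he _ (isHomogeneous_subst L.symm.toLinearMap hF)]
      refine Finset.sum_congr rfl fun P _ => ?_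
      rw [eval_subst]
      simp [b]
    | succ i ih =>
      intro F hF
      obtain ⟨U, V, F', hF', rfl⟩ := exists_eq_combination hH₁h hH₂h hL0 hcop
        (d := k + i) (by omega) hF
      rw [← ih F' hF']
      refine Finset.sum_congr rfl fun P hP => ?_
      have := hb2 P hP
      simp only [map_add, map_mul, hb₁ P hP, hb₂ P hP, eval_X, mul_zero, zero_add, pow_succ]
      field_simp
  intro P₀ hP₀
  obtain ⟨l, hl, hl0⟩ : ∃ l : MvPolynomial (Fin 3) ℂ, l.IsHomogeneous 1 ∧ eval P₀.rep l ≠ 0 := by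
    obtain ⟨i, hi⟩ := Function.ne_iff.1 P₀.rep_nonzero
    exact ⟨X i, isHomogeneous_X _ _, by simpa using hi⟩
  have hsep : ∀ Q : PSpace 2, Q ≠ P₀ → ∃ m : MvPolynomial (Fin 3) ℂ, m.IsHomogeneous 1 ∧
    eval P₀.rep m ≠ 0 ∧ eval Q.rep m = 0 := fun Q hQ => exists_linear_separating hQ.symm
  choose! m hm hm1 hm2 using hsep
  have hprod : (∏ Q ∈ Z.erase P₀, m Q).IsHomogeneous (Z.erase P₀).card := by
    simpa using IsHomogeneous.prod (Z.erase P₀) m (fun _ => 1)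
      fun Q hQ => hm Q (Finset.ne_of_mem_erase hQ)
  -- The test form vanishes on `Z` except at `P₀`; the factor `l ^ k` only adjusts the degree.
  have hF := key _ _ (isHomogeneous_subst L.toLinearMap
    (((by simpa using hl.pow k : (l ^ k).IsHomogeneous k)).mul hprod))
  simp only [hb] at hF
  rw [Finset.sum_eq_single P₀] at hF
  · rw [map_mul, map_pow, map_prod] at hF
    have h3 : ∏ Q ∈ Z.erase P₀, eval P₀.rep (m Q) ≠ 0 :=
      Finset.prod_ne_zero_iff.2 fun Q hQ => hm1 Q (Finset.ne_of_mem_erase hQ)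
    have h4 := pow_ne_zero (Z.erase P₀).card (inv_ne_zero (hb2 P₀ hP₀))
    have h5 := mul_ne_zero (pow_ne_zero k hl0) h3
    exact (mul_eq_zero.1 ((mul_eq_zero.1 hF).resolve_right h5)).resolve_right h4
  · intro Q hQ hne
    rw [map_mul, map_prod, Finset.prod_eq_zero (Finset.mem_erase.2 ⟨hne, hQ⟩) (hm2 Q hne)]
    simp
  · exact fun h => absurd hP₀ h

/-! ### Factors of forms -/

/-- The substitution `F(x) ↦ F(t x)`, which encodes the decomposition of `F` into forms. -/
noncomputable def homogenize (σ : Type*) :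
    MvPolynomial σ ℂ →ₐ[ℂ] Polynomial (MvPolynomial σ ℂ) :=
  aeval fun i => Polynomial.C (X i) * Polynomial.X

theorem coeff_coeff_homogenize {σ : Type*} (A : MvPolynomial σ ℂ) (k : ℕ) (α : σ →₀ ℕ) :
    coeff α ((homogenize σ A).coeff k) = if α.degree = k then coeff α A else 0 := by
  classical
  induction A using MvPolynomial.induction_on' with
  | monomial β c =>
    have h : homogenize σ (monomial β c) = Polynomial.monomial β.degree (monomial β c) := by
      rw [homogenize, aeval_monomial, Finsupp.prod]
      simp only [mul_pow, Finset.prod_mul_distrib, Finset.prod_pow_eq_pow_sum]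
      rw [← Polynomial.C_mul_X_pow_eq_monomial, monomial_eq, Polynomial.C_mul, ← mul_assoc,
        Finsupp.prod, map_prod]
      simp only [map_pow]
      rfl
    rw [h, Polynomial.coeff_monomial, coeff_monomial]
    by_cases hβ : β = α
    · subst hβ
      split_ifs <;> simp_all
    · simp only [hβ, if_false, ite_self]
      split_ifs <;> simp [hβ]
  | add p q hp hq =>
    rw [map_add, Polynomial.coeff_add, coeff_add, hp, hq, coeff_add]
    split_ifs <;> simp

/-- The factors of a nonzero form are forms. -/
theorem exists_isHomogeneous_of_mul {σ : Type*} {A B : MvPolynomial σ ℂ} {d : ℕ}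
    (h : (A * B).IsHomogeneous d) (h0 : A * B ≠ 0) :
    ∃ a b, a + b = d ∧ A.IsHomogeneous a ∧ B.IsHomogeneous b := by
  classical
  -- The product is a single power of t. Lowest and highest degrees in t are additive, so they
  -- coincide for each factor.
  have hAB : homogenize σ A * homogenize σ B = Polynomial.monomial d (A * B) := by
    rw [← map_mul]
    ext k α
    rw [coeff_coeff_homogenize, Polynomial.coeff_monomial]
    by_cases hα : α.degree = d
    · rw [hα]
      split_ifs <;> simp
    · have := h.coeff_eq_zero hα
      split_ifs <;> simp [this]
  have hne : homogenize σ A * homogenize σ B ≠ 0 := by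
    rw [hAB]
    simpa using h0
  have hA := left_ne_zero_of_mul hne
  have hB := right_ne_zero_of_mul hne
  have h1 := Polynomial.natDegree_mul hA hB
  have h2 := Polynomial.natTrailingDegree_mul hA hB
  rw [hAB, Polynomial.natDegree_monomial_eq _ h0] at h1
  rw [hAB, Polynomial.natTrailingDegree_monomial h0] at h2
  have hA' := Polynomial.natTrailingDegree_le_natDegree (homogenize σ A)
  have hB' := Polynomial.natTrailingDegree_le_natDegree (homogenize σ B)
  have key : ∀ F : MvPolynomial σ ℂ,
      (homogenize σ F).natTrailingDegree = (homogenize σ F).natDegree →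
      F.IsHomogeneous (homogenize σ F).natDegree := by
    intro F hF α hα
    have h3 : (homogenize σ F).coeff α.degree ≠ 0 := by
      intro h
      have := coeff_coeff_homogenize F α.degree α
      rw [h] at this
      simp at this
      exact hα this.symm
    have h4 := Polynomial.le_natDegree_of_ne_zero h3
    have h5 := Polynomial.natTrailingDegree_le_of_ne_zero h3
    rw [Finsupp.degree_eq_weight_one] at h4 h5
    exact le_antisymm h4 (hF ▸ h5)
  exact ⟨_, _, h1.symm, key A (by omega), key B (by omega)⟩

/-! ### Odd degree with many points -/

/-- If the degree `a + b` functional of `A` and `B` agree, many points of `A` are separated in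
degree `a`, and `A` is separated in degree `b`, then the forms of degree `b` that vanish on `A`
and the ones that vanish on `B` have a large intersection. -/
theorem card_add_finrank_ge {n a b : ℕ} {A A' B : Finset (PSpace n)} (hA' : A' ⊆ A)
    (hsep : Separates a A') (hAb : Separates b A) {c c' : PSpace n → ℂ} (hc : ∀ P ∈ A, c P ≠ 0)
    (h : ∀ F : MvPolynomial (Fin (n + 1)) ℂ, F.IsHomogeneous (a + b) →
      ∑ P ∈ A, c P * eval P.rep F = ∑ P ∈ B, c' P * eval P.rep F)
    (hcard : A'.card = (n + a).choose n) :
    (n + b).choose n + (n + a).choose n ≤ A.card + B.card +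
      Module.finrank ℂ (LinearMap.ker (evalMap b fun P : A => P.1.rep) ⊓
        LinearMap.ker (evalMap b fun P : B => P.1.rep) : Submodule ℂ (Form n b)) := by
  classical
  choose! F hF hF1 hF2 using hsep
  choose! G hG hG1 hG2 using hAb
  -- Contraction with the common functional, tested on the separators of `A'`.
  let Ψ : Form n b →ₗ[ℂ] (A' → ℂ) :=
    { toFun := fun g P => ∑ Q ∈ A, c Q * (eval Q.rep (F P.1) * eval Q.rep g.1)
      map_add' := by
        intro g g'
        funext P
        simp [mul_add, Finset.sum_add_distrib]
      map_smul' := by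
        intro t g
        funext P
        simp only [SetLike.val_smul, smul_eval, Pi.smul_apply, smul_eq_mul, Finset.mul_sum,
          RingHom.id_apply]
        exact Finset.sum_congr rfl fun Q _ => by ring }
  -- For `P ∈ A'`, `G P` is sent to `c P` times the coordinate vector of `P`.
  have hsurj : LinearMap.range Ψ = ⊤ := by
    rw [LinearMap.range_eq_top]
    intro w
    refine ⟨∑ P : A', (w P / c P) • (⟨G P.1, hG P.1 (hA' P.2)⟩ : Form n b), ?_⟩
    rw [map_sum]
    funext R
    simp only [map_smul, Finset.sum_apply, Pi.smul_apply, smul_eq_mul]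
    have hΨ : ∀ P : A', Ψ ⟨G P.1, hG P.1 (hA' P.2)⟩ R = c P * eval P.1.rep (F R.1) := by
      intro P
      change ∑ Q ∈ A, c Q * (eval Q.rep (F R.1) * eval Q.rep (G P.1)) = _
      rw [Finset.sum_eq_single P.1]
      · rw [hG1 _ (hA' P.2), mul_one]
      · intro Q hQ hne
        rw [hG2 _ (hA' P.2) Q hQ hne]
        simp
      · exact fun hh => absurd (hA' P.2) hh
    simp only [hΨ]
    rw [Finset.sum_eq_single R]
    · rw [hF1 _ R.2]
      field_simp [hc _ (hA' R.2)]
    · intro P _ hne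
      rw [hF2 R.1 R.2 P.1 P.2 fun hh => hne (Subtype.ext hh)]
      simp
    · simp
  set IA := LinearMap.ker (evalMap (n := n) b fun P : A => P.1.rep) with hIA
  set IB := LinearMap.ker (evalMap (n := n) b fun P : B => P.1.rep) with hIB
  have hleA : IA ≤ LinearMap.ker Ψ := by
    intro g hg
    rw [LinearMap.mem_ker] at hg ⊢
    funext P
    refine Finset.sum_eq_zero fun Q hQ => ?_
    have : eval Q.rep g.1 = 0 := congrFun hg ⟨Q, hQ⟩
    rw [this]
    simp
  have hleB : IB ≤ LinearMap.ker Ψ := by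
    intro g hg
    rw [LinearMap.mem_ker] at hg ⊢
    funext P
    have h1 := h (F P.1 * g.1) ((hF P.1 P.2).mul g.2)
    simp only [map_mul] at h1
    change ∑ Q ∈ A, c Q * (eval Q.rep (F P.1) * eval Q.rep g.1) = 0
    rw [h1]
    refine Finset.sum_eq_zero fun Q hQ => ?_
    have : eval Q.rep g.1 = 0 := congrFun hg ⟨Q, hQ⟩
    rw [this]
    simp
  -- `IA ⊔ IB` lies in the kernel of `Ψ`, of codimension |A'|, while `IA` and `IB` have codimension
  -- at most |A| and |B|; this bounds `IA ⊓ IB` from below.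
  have e1 := LinearMap.finrank_range_add_finrank_ker Ψ
  have e2 : Module.finrank ℂ (LinearMap.range (evalMap (n := n) b fun P : A => P.1.rep)) +
    Module.finrank ℂ IA = _ := LinearMap.finrank_range_add_finrank_ker _
  have e3 : Module.finrank ℂ (LinearMap.range (evalMap (n := n) b fun P : B => P.1.rep)) +
    Module.finrank ℂ IB = _ := LinearMap.finrank_range_add_finrank_ker _
  have e4 := Submodule.finrank_le (LinearMap.range (evalMap (n := n) b fun P : A => P.1.rep))
  have e5 := Submodule.finrank_le (LinearMap.range (evalMap (n := n) b fun P : B => P.1.rep))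
  have e6 := Submodule.finrank_sup_add_finrank_inf_eq IA IB
  have e7 := Submodule.finrank_mono (sup_le hleA hleB)
  rw [hsurj, finrank_top, finrank_form, Module.finrank_fintype_fun_eq_card, Fintype.card_coe] at e1
  rw [finrank_form] at e2 e3
  rw [Module.finrank_fintype_fun_eq_card, Fintype.card_coe] at e4 e5
  omega

theorem exists_pair_of_two_le_finrank {V : Type*} [AddCommGroup V] [Module ℂ V]
    {I : Submodule ℂ V} (h : 2 ≤ Module.finrank ℂ I) :
    ∃ x ∈ I, ∃ y ∈ I, x ≠ 0 ∧ ∀ t : ℂ, t • x ≠ y := by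
  have : Nontrivial I := Module.nontrivial_of_finrank_pos (R := ℂ) (by omega)
  obtain ⟨x, hx⟩ := exists_ne (0 : I)
  by_contra! hall
  have hx0 : (x : V) ≠ 0 := fun hh => hx (Subtype.ext hh)
  have := finrank_le_one x fun y => by
    obtain ⟨t, ht⟩ := hall x x.2 y y.2 hx0
    exact ⟨t, Subtype.ext ht⟩
  omega

/-- The case of odd degree `2 m + 1` and more points than there are conditions in degree `m`. -/
theorem card_le_card_of_odd {m : ℕ} {A B : Finset (PSpace 2)}
    (hsep : ∀ A' ⊆ A, A'.card ≤ (2 + m).choose 2 → Separates m A')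
    (hA1 : Separates (m + 1) A) (hlarge : (2 + m).choose 2 ≤ A.card)
    (hcard : 2 * A.card ≤ 2 * (2 + m).choose 2 + m + 1)
    {c c' : PSpace 2 → ℂ} (hc : ∀ P ∈ A, c P ≠ 0)
    (h : ∀ F : MvPolynomial (Fin 3) ℂ, F.IsHomogeneous (m + (m + 1)) →
      ∑ P ∈ A, c P * eval P.rep F = ∑ P ∈ B, c' P * eval P.rep F) : A.card ≤ B.card := by
  classical
  by_contra! hlt
  obtain ⟨A₀, hA₀, hA₀c⟩ := Finset.exists_subset_card_eq hlarge
  have hdim := card_add_finrank_ge hA₀ (hsep A₀ hA₀ hA₀c.le) hA1 hc h hA₀c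
  have hchoose : (2 + (m + 1)).choose 2 = (2 + m).choose 2 + (m + 2) := by
    rw [add_comm _ (m + 2), add_comm m 2]
    have hpascal := Nat.choose_succ_succ' (2 + m) 1
    rw [Nat.choose_one_right] at hpascal
    exact hpascal
  -- With N = `(2 + m).choose 2` the dimension is at least 2N + m + 2 - |A| - |B|, which is at least
  -- 2 by `hcard` and |B| < |A|.
  obtain ⟨g₁, hg₁, g₂, hg₂, hg0, hind⟩ := exists_pair_of_two_le_finrank
    (I := LinearMap.ker (evalMap (m + 1) fun P : A => P.1.rep) ⊓
        LinearMap.ker (evalMap (m + 1) fun P : B => P.1.rep)) (by omega)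
  have hvan : ∀ g ∈ (LinearMap.ker (evalMap (m + 1) fun P : A => P.1.rep) ⊓
        LinearMap.ker (evalMap (m + 1) fun P : B => P.1.rep) : Submodule ℂ (Form 2 (m + 1))),
      ∀ P ∈ A ∪ B, eval P.rep g.1 = 0 := by
    rintro g ⟨hgA, hgB⟩ P hP
    rcases Finset.mem_union.1 hP with hP | hP
    · exact congrFun (LinearMap.mem_ker.1 hgA) ⟨P, hP⟩
    · exact congrFun (LinearMap.mem_ker.1 hgB) ⟨P, hP⟩
  have hg0' : g₁.1 ≠ 0 := fun hh => hg0 (Subtype.ext hh)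
  have hg20 : g₂.1 ≠ 0 := fun hh => hind 0 (by rw [zero_smul]; exact Subtype.ext hh.symm)
  obtain ⟨G₁, G₂, H, hrel, hH₁, hH₂⟩ :=
    UniqueFactorizationMonoid.exists_reduced_factors g₁.1 hg0' g₂.1
  obtain ⟨e, n, hen, hHe, hG₁⟩ := exists_isHomogeneous_of_mul (d := m + 1)
    (hH₁ ▸ g₁.2) (hH₁ ▸ hg0')
  obtain ⟨e', n', hen', hHe', hG₂⟩ := exists_isHomogeneous_of_mul (d := m + 1)
    (hH₂ ▸ g₂.2) (hH₂ ▸ hg20)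
  have hH0 : H ≠ 0 := left_ne_zero_of_mul (hH₁ ▸ hg0')
  have hG₁0 : G₁ ≠ 0 := right_ne_zero_of_mul (hH₁ ▸ hg0')
  obtain rfl : e' = e := hHe'.inj_right hHe hH0
  obtain rfl : n' = n := by omega
  -- Otherwise the cofactors are constants and `g₁`, `g₂` are proportional.
  have hn : n' ≠ 0 := by
    rintro rfl
    rw [← totalDegree_zero_iff_isHomogeneous, totalDegree_eq_zero_iff_eq_C] at hG₁ hG₂
    have h1 : coeff 0 G₁ ≠ 0 := by
      intro hh
      rw [hh, C_0] at hG₁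
      exact hG₁0 hG₁
    apply hind (coeff 0 G₂ / coeff 0 G₁)
    apply Subtype.ext
    rw [SetLike.val_smul, ← hH₁, ← hH₂, hG₁, hG₂, smul_eq_C_mul, coeff_zero_C, coeff_zero_C,
      mul_left_comm, ← C_mul, div_mul_cancel₀ _ h1]
  let w : PSpace 2 → ℂ := fun P => (if P ∈ A then c P else 0) - (if P ∈ B then c' P else 0)
  have hw : ∀ F : MvPolynomial (Fin 3) ℂ, F.IsHomogeneous (m + (m + 1)) →
      ∑ P ∈ A ∪ B, w P * eval P.rep F = 0 := by
    intro F hF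
    simp only [w, sub_mul, ite_mul, zero_mul, Finset.sum_sub_distrib]
    rw [Finset.sum_ite_mem, Finset.sum_ite_mem, Finset.union_inter_cancel_left,
      Finset.union_inter_cancel_right, h F hF, sub_self]
  -- Multiplication by `H` raises degree m+n' to 2m+1, and n' ≤ m+1 is exactly the degree bound
  -- required.
  have hzero := eq_zero_of_sum_eval_eq_zero (k := m + n') hG₁ hG₂ hG₁0 hrel
    (Z := (A ∪ B).filter fun P => eval P.rep H ≠ 0) (e := fun P => w P * eval P.rep H)
    (by
      intro P hP
      rw [Finset.mem_filter] at hP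
      have := hvan g₁ hg₁ P hP.1
      rw [← hH₁, map_mul] at this
      exact (mul_eq_zero.1 this).resolve_left hP.2)
    (by
      intro P hP
      rw [Finset.mem_filter] at hP
      have := hvan g₂ hg₂ P hP.1
      rw [← hH₂, map_mul] at this
      exact (mul_eq_zero.1 this).resolve_left hP.2)
    (by omega)
    (by
      intro F hF
      have hHF := hHe.mul hF
      rw [show e' + (m + n') = m + (m + 1) by omega] at hHF
      refine Eq.trans ?_ (hw _ hHF)
      rw [Finset.sum_filter]
      refine Finset.sum_congr rfl fun P _ => ?_
      rw [map_mul]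
      split_ifs with h0
      · ring
      · rw [not_not.1 h0]
        ring)
  have hw0 : ∀ P ∈ A ∪ B, eval P.rep H ≠ 0 → w P = 0 := fun P hP hPH =>
    (mul_eq_zero.1 (hzero P (Finset.mem_filter.2 ⟨hP, hPH⟩))).resolve_right hPH
  set AH := A.filter fun P => eval P.rep H = 0 with hAH
  set BH := B.filter fun P => eval P.rep H = 0 with hBH
  have hAHN : AH.card ≤ (2 + m).choose 2 := by
    by_contra! hgt
    obtain ⟨A₁, hA₁, hA₁c⟩ := Finset.exists_subset_card_eq hgt.le
    have hA₁A : A₁ ⊆ A := hA₁.trans (Finset.filter_subset _ _)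
    -- `n' ≠ 0` gives `e' ≤ m`, so `H` can be padded to degree `m`.
    have hform := hHe.mul ((isHomogeneous_X_pow (R := ℂ) (0 : Fin 3) (m - e')))
    rw [show e' + (m - e') = m by omega] at hform
    have := (hsep A₁ hA₁A hA₁c.le).eq_zero hA₁c hform (by
      intro P hP
      rw [map_mul, (Finset.mem_filter.1 (hA₁ hP)).2, zero_mul])
    exact mul_ne_zero hH0 (pow_ne_zero _ (X_ne_zero _)) this
  have hAHA : AH ⊆ A := Finset.filter_subset _ _
  -- Since `w` vanishes off `H`, the parts of the two sums on `H` agree as functionals.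
  have hcardH : AH.card ≤ BH.card := by
    refine card_le_card_of_separates (c := c) (c' := c') (hsep AH hAHA hAHN) (hA1.mono hAHA)
      (fun P hP => hc P (hAHA hP)) ?_
    intro F hF
    have h1 := hw F hF
    rw [← Finset.sum_filter_add_sum_filter_not (A ∪ B) (fun P => eval P.rep H = 0),
      Finset.sum_eq_zero (s := (A ∪ B).filter fun P => ¬ eval P.rep H = 0) (fun P hP => by
        rw [hw0 P (Finset.mem_filter.1 hP).1 (Finset.mem_filter.1 hP).2, zero_mul]),
      add_zero, Finset.filter_union, ← hAH, ← hBH] at h1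
    have h2 : ∀ P ∈ AH ∪ BH, w P * eval P.rep F =
        (if P ∈ AH then c P * eval P.rep F else 0) -
          (if P ∈ BH then c' P * eval P.rep F else 0) := by
      intro P hP
      have hPH : eval P.rep H = 0 := by
        rcases Finset.mem_union.1 hP with hP | hP <;> exact (Finset.mem_filter.1 hP).2
      simp only [w, hAH, hBH, Finset.mem_filter, hPH, and_true, sub_mul, ite_mul, zero_mul]
    rw [Finset.sum_congr rfl h2, Finset.sum_sub_distrib, Finset.sum_ite_mem, Finset.sum_ite_mem,
      Finset.union_inter_cancel_left, Finset.union_inter_cancel_right] at h1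
    exact sub_eq_zero.1 h1
  have hsub : (A.filter fun P => ¬ eval P.rep H = 0) ⊆ B.filter fun P => ¬ eval P.rep H = 0 := by
    intro P hP
    obtain ⟨hPA, hPH⟩ := Finset.mem_filter.1 hP
    refine Finset.mem_filter.2 ⟨?_, hPH⟩
    by_contra hPB
    have := hw0 P (Finset.mem_union_left _ hPA) hPH
    simp only [w, hPA, hPB, if_true, if_false, sub_zero] at this
    exact hc P hPA this
  have h3 := Finset.card_le_card hsub
  have h4 := Finset.card_filter_add_card_filter_not (s := A) (fun P => eval P.rep H = 0)
  have h5 := Finset.card_filter_add_card_filter_not (s := B) (fun P => eval P.rep H = 0)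
  rw [← hAH] at h4
  rw [← hBH] at h5
  omega

/-! ### From functionals to the rank -/

theorem computesRank_of_forall {n d : ℕ} {T : Form n d} {A : Finset (PSpace n)}
    (hA : NonRedundant A T) (h : ∀ B, Computes B T → A.card ≤ B.card) : ComputesRank A T := by
  refine ⟨hA, le_antisymm (le_csInf ⟨A.card, A, hA.1, rfl⟩ ?_) (Nat.sInf_le ⟨A, hA.1, rfl⟩)⟩
  rintro _ ⟨B, hB, rfl⟩
  exact h B hB

/-- The coefficients of a non-redundant decomposition do not vanish, and every other decomposition
gives the same functional on forms of degree `d`. -/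
theorem NonRedundant.exists_coeff {n d : ℕ} {T : Form n d} {A : Finset (PSpace n)}
    (hA : NonRedundant A T) : ∃ c : PSpace n → ℂ, (∀ P ∈ A, c P ≠ 0) ∧
      ∀ B, Computes B T → ∃ c' : PSpace n → ℂ, ∀ F : MvPolynomial (Fin (n + 1)) ℂ,
        F.IsHomogeneous d → ∑ P ∈ A, c P * eval P.rep F = ∑ P ∈ B, c' P * eval P.rep F := by
  classical
  obtain ⟨c, hc⟩ := (computes_iff A T).1 hA.1
  refine ⟨c, fun P hP h0 => ?_, fun B hB => ?_⟩
  · apply hA.2 (A.erase P) (Finset.erase_ssubset hP)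
    rw [computes_iff]
    refine ⟨c, ?_⟩
    rw [← hc, ← Finset.add_sum_erase A _ hP, h0, zero_smul, zero_add]
  · obtain ⟨c', hc'⟩ := (computes_iff B T).1 hB
    refine ⟨c', ?_⟩
    have h := (sum_smul_powForm_eq_zero_iff (d := d) (A.disjSum B) (Sum.elim c fun P => -c' P)
      (Sum.elim (fun P => P.rep) fun P => P.rep)).1 (by
        rw [Finset.sum_disjSum]
        simp only [Sum.elim_inl, Sum.elim_inr]
        rw [hc, ← hc', ← Finset.sum_add_distrib]
        refine Finset.sum_eq_zero fun P _ => ?_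
        rw [← add_smul, add_neg_cancel, zero_smul])
    intro F hF
    have h1 := h F hF
    rw [Finset.sum_disjSum] at h1
    simp only [Sum.elim_inl, Sum.elim_inr, neg_mul, Finset.sum_neg_distrib] at h1
    exact sub_eq_zero.1 ((sub_eq_add_neg _ _).trans h1)

end Waring


theorem theorem3p7 (d : ℕ) (T : Waring.Form 2 d) (A : Finset (Waring.PSpace 2))
    (hA : Waring.NonRedundant A T) :
    (∀ m : ℕ, d = 2 * m → Waring.hilbertFun A m = A.card →
      A.card ≤ (m + 2).choose 2 ∧ Waring.ComputesRank A T) ∧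
    (∀ m : ℕ, d = 2 * m + 1 →
      Waring.kruskalRank m A = min ((m + 2).choose 2) A.card →
      Waring.hilbertFun A (m + 1) = A.card →
      A.card ≤ (m + 2).choose 2 + ⌈(m : ℚ) / 2⌉₊ →
      Waring.ComputesRank A T) := by
  obtain ⟨c, hc, hT⟩ := hA.exists_coeff
  constructor
  · rintro m rfl hm
    have hsep := Waring.separates_of_hilbertFun hm
    refine ⟨add_comm 2 m ▸ hsep.card_le, Waring.computesRank_of_forall hA fun B hB => ?_⟩
    obtain ⟨c', h⟩ := hT B hB
    exact Waring.card_le_card_of_separates hsep hsep hc (two_mul m ▸ h)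
  · rintro m rfl hk hm hcard
    rw [add_comm m 2] at hk hcard
    have hsep1 := Waring.separates_of_hilbertFun hm
    have hsep : ∀ A' ⊆ A, A'.card ≤ (2 + m).choose 2 → Waring.Separates m A' := by
      intro A' hA' hle
      refine Waring.separates_of_card_le_kruskalRank hA' ?_ ?_
      -- For `m = 0` the binomial coefficient is 1, so `A'` has at most one point.
      · rintro rfl
        simpa using hle
      · rw [hk]
        exact le_min hle (Finset.card_le_card hA')
    refine Waring.computesRank_of_forall hA fun B hB => ?_
    obtain ⟨c', h⟩ := hT B hB
    rw [show 2 * m + 1 = m + (m + 1) by ring] at h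
    rcases le_total A.card ((2 + m).choose 2) with hle | hle
    · exact Waring.card_le_card_of_separates (hsep A subset_rfl hle) hsep1 hc h
    · refine Waring.card_le_card_of_odd hsep hsep1 hle ?_ hc h
      -- The cardinality bound enters in the doubled form 2|A| ≤ 2N + m + 1.
      have hceil : 2 * ⌈(m : ℚ) / 2⌉₊ ≤ m + 1 := by
        have h1 : ⌈(m : ℚ) / 2⌉₊ ≤ (m + 1) / 2 := by
          rw [Nat.ceil_le, div_le_iff₀ (by norm_num)]
          have : m ≤ (m + 1) / 2 * 2 := by omega
          exact_mod_cast this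
        omega
      omega
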